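/- Let $\mathbb K=\mathbb R$ or $\mathbb C$, let $\alpha=(\alpha_n)_{n\ge 0}$ be an increasing (not necessarily strictly increasing) sequence of strictly positive real numbers with $\alpha_n\to\infty$, and let $r\in\mathbb R$. For $1\le p<\infty$ let \[ \Lambda_{p,r}(\alpha)=\Big\{x\in\mathbb K^{\mathbb N_0}:\ \sum_{n\ge 0}|x_n|^pe^{t\alpha_n}<\infty\ \text{ for all } t<r\Big\}, \] with the locally convex topology given by the seminorms $\|x\|_t=\big(\sum_{n}|x_n|^pe^{t\alpha_n}\big)^{1/p}$, $t<r$, and let \[ C_{0,r}(\alpha)=\Big\{x\in\mathbb K^{\mathbb N_0}:\ \lim_{n\to\infty}|x_n|e^{t\alpha_n}=0\ \text{ for all } t<r\Big\}, \] with the seminorms $\|x\|_t=\sup_n|x_n|e^{t\alpha_n}$, $t<r$ (the power series spaces of finite type $r$ and of order $p$ and $0$, respectively). A weighted shift on such a space $X$ is a continuous linear operator $B_w:X\to X$ of the form $B_w(x_n)_{n\ge 0}=(w_{n+1}x_{n+1})_{n\ge 0}$, where $w$ is a sequence of non-zero scalars. An operator $T$ on $X$ is chaotic if it has a dense orbit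 and a dense set of periodic points; it is frequently hypercyclic if there is $x\in X$ such that for every non-empty open $U\subset X$ the set $\{n\ge 0: T^nx\in U\}$ has positive lower density, where the lower density of $A\subset\mathbb N_0$ is $\liminf_{N\to\infty}\frac{1}{N+1}\operatorname{card}\{n\le N:n\in A\}$. **Theorem 4.9.** Let $X=\Lambda_{p,r}(\alpha)$ with $1\le p<\infty$, or $X=C_{0,r}(\alpha)$. Suppose that \[ \limsup_{n\to\infty}\frac{\alpha_{n+1}}{\alpha_n}<\infty \] and that \[ \begin{cases} \displaystyle\exists\,\varepsilon\in(0,1)\ \forall\,\delta>0\ \exists\, j\ge 1:\ \sum_{n\ge j}\varepsilon^{-\alpha_{n-j}+\delta\alpha_n}<\infty, & \text{if } X=\Lambda_{p,r}(\alpha),\\[1ex] \displaystyle\limsup_{j\to\infty}\liminf_{n\to\infty}\frac{\alpha_{n+j}}{\alpha_n}=\infty, & \text{if } X=C_{0,r}(\alpha). \end{cases} \] Then there exists a chaotic weighted shift on $X$, and there exists a frequently hypercyclic weighted shift on $X$ that is not chaotic. -/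

import Mathlib

open Filter Topology

noncomputable section

/-! ### Power series spaces of finite type -/

/-- Closure under addition of weighted `ℓ^p`-summability, with Minkowski's inequality. -/
theorem weighted_minkowski {𝕜 : Type*} [RCLike 𝕜] {p : ℝ} (hp : 1 ≤ p) (a : ℕ → ℝ)
    (x y : ℕ → 𝕜)
    (hx : Summable fun n => ‖x n‖ ^ p * Real.exp (a n))
    (hy : Summable fun n => ‖y n‖ ^ p * Real.exp (a n)) :
    (Summable fun n => ‖x n + y n‖ ^ p * Real.exp (a n)) ∧
    (∑' n, ‖x n + y n‖ ^ p * Real.exp (a n)) ^ (1 / p) ≤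
      (∑' n, ‖x n‖ ^ p * Real.exp (a n)) ^ (1 / p) +
        (∑' n, ‖y n‖ ^ p * Real.exp (a n)) ^ (1 / p) := by
  have hp0 : p ≠ 0 := by positivity
  have key : ∀ (u : ℝ) (n : ℕ), 0 ≤ u →
      u ^ p * Real.exp (a n) = (u * Real.exp (a n / p)) ^ p := by
    intro u n hu
    rw [Real.mul_rpow hu (Real.exp_pos _).le, ← Real.exp_mul, div_mul_cancel₀ _ hp0]
  simp only [key _ _ (norm_nonneg _)] at hx hy ⊢
  have h1 := Real.Lp_add_le_tsum_of_nonneg hp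
    (fun n => by positivity : ∀ n, 0 ≤ ‖x n‖ * Real.exp (a n / p))
    (fun n => by positivity : ∀ n, 0 ≤ ‖y n‖ * Real.exp (a n / p)) hx hy
  have hle : ∀ n, (‖x n + y n‖ * Real.exp (a n / p)) ^ p ≤
      (‖x n‖ * Real.exp (a n / p) + ‖y n‖ * Real.exp (a n / p)) ^ p := by
    intro n
    rw [← add_mul]
    gcongr
    exact norm_add_le _ _
  have hs : Summable fun n => (‖x n + y n‖ * Real.exp (a n / p)) ^ p :=
    Summable.of_nonneg_of_le (fun n => by positivity) hle h1.1
  refine ⟨hs, le_trans ?_ h1.2⟩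
  exact Real.rpow_le_rpow (tsum_nonneg fun n => by positivity)
    (hs.tsum_le_tsum hle h1.1) (by positivity)

/-- The set of sequences `x` with `∑ |x_n|^p e^{t α_n} < ∞` for all `t < r`. -/
def lambdaSubmodule (𝕜 : Type*) [RCLike 𝕜] (p : ℝ) (hp : 1 ≤ p) (r : ℝ) (α : ℕ → ℝ) :
    Submodule 𝕜 (ℕ → 𝕜) where
  carrier := {x | ∀ t < r, Summable fun n => ‖x n‖ ^ p * Real.exp (t * α n)}
  add_mem' := fun {x y} hx hy t ht =>
    (weighted_minkowski hp (fun n => t * α n) x y (hx t ht) (hy t ht)).1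
  zero_mem' := fun t _ => by
    have hp0 : p ≠ 0 := by positivity
    simp [Real.zero_rpow hp0, summable_zero]
  smul_mem' := fun c x hx t ht => by
    have h := (hx t ht).mul_left (‖c‖ ^ p)
    refine h.congr fun n => ?_
    simp only [Pi.smul_apply, norm_smul]
    rw [Real.mul_rpow (norm_nonneg _) (norm_nonneg _)]
    ring

/-- The power series space `Λ_{p,r}(α)` of order `p ∈ [1,∞)` and finite type `r`. It is a type of
its own, so that it does not inherit the topology of coordinatewise convergence. -/
def PowerSeriesSpace (𝕜 : Type*) [RCLike 𝕜] (p : ℝ) (hp : 1 ≤ p) (r : ℝ) (α : ℕ → ℝ) : Type _ :=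
  lambdaSubmodule 𝕜 p hp r α

namespace PowerSeriesSpace

variable {𝕜 : Type*} [RCLike 𝕜] {p : ℝ} {hp : 1 ≤ p} {r : ℝ} {α : ℕ → ℝ}

instance : AddCommGroup (PowerSeriesSpace 𝕜 p hp r α) :=
  inferInstanceAs (AddCommGroup (lambdaSubmodule 𝕜 p hp r α))

instance : Module 𝕜 (PowerSeriesSpace 𝕜 p hp r α) :=
  inferInstanceAs (Module 𝕜 (lambdaSubmodule 𝕜 p hp r α))

/-- The sequence of coordinates of an element. -/
def coord (𝕜 : Type*) [RCLike 𝕜] (p : ℝ) (hp : 1 ≤ p) (r : ℝ) (α : ℕ → ℝ) :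
    PowerSeriesSpace 𝕜 p hp r α →ₗ[𝕜] (ℕ → 𝕜) :=
  (lambdaSubmodule 𝕜 p hp r α).subtype

theorem coord_mem (x : PowerSeriesSpace 𝕜 p hp r α) (t : ℝ) (ht : t < r) :
    Summable fun n => ‖coord 𝕜 p hp r α x n‖ ^ p * Real.exp (t * α n) :=
  x.2 t ht

/-- The seminorms `‖x‖_t = (∑ |x_n|^p e^{t α_n})^{1/p}`, for `t < r`. -/
def seminorms (𝕜 : Type*) [RCLike 𝕜] (p : ℝ) (hp : 1 ≤ p) (r : ℝ) (α : ℕ → ℝ) :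
    SeminormFamily 𝕜 (PowerSeriesSpace 𝕜 p hp r α) (Set.Iio r) := fun t =>
  Seminorm.of
    (fun x => (∑' n, ‖coord 𝕜 p hp r α x n‖ ^ p * Real.exp ((t : ℝ) * α n)) ^ (1 / p))
    (fun x y => by
      simp only [map_add, Pi.add_apply]
      exact (weighted_minkowski hp (fun n => (t : ℝ) * α n) _ _
        (coord_mem x t t.2) (coord_mem y t t.2)).2)
    (fun c x => by
      have hp0 : p ≠ 0 := by positivity
      have h : ∀ n, ‖coord 𝕜 p hp r α (c • x) n‖ ^ p * Real.exp ((t : ℝ) * α n) =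
          ‖c‖ ^ p * (‖coord 𝕜 p hp r α x n‖ ^ p * Real.exp ((t : ℝ) * α n)) := by
        intro n
        rw [map_smul, Pi.smul_apply, norm_smul,
          Real.mul_rpow (norm_nonneg _) (norm_nonneg _), mul_assoc]
      simp only [h]
      rw [tsum_mul_left, Real.mul_rpow (by positivity) (tsum_nonneg fun n => by positivity),
        ← Real.rpow_mul (norm_nonneg _), mul_one_div_cancel hp0, Real.rpow_one])

/-- The locally convex topology generated by the seminorms. -/
instance : TopologicalSpace (PowerSeriesSpace 𝕜 p hp r α) :=
  (seminorms 𝕜 p hp r α).moduleFilterBasis.topology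

theorem withSeminorms : WithSeminorms (seminorms 𝕜 p hp r α) := ⟨rfl⟩

end PowerSeriesSpace

/-- The set of sequences `x` with `|x_n| e^{t α_n} → 0` for all `t < r`. -/
def zeroSubmodule (𝕜 : Type*) [RCLike 𝕜] (r : ℝ) (α : ℕ → ℝ) : Submodule 𝕜 (ℕ → 𝕜) where
  carrier := {x | ∀ t < r, Tendsto (fun n => ‖x n‖ * Real.exp (t * α n)) atTop (𝓝 0)}
  add_mem' := fun {x y} hx hy t ht => by
    have h := (hx t ht).add (hy t ht)
    rw [add_zero] at h
    refine squeeze_zero (fun n => by positivity) (fun n => ?_) h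
    rw [← add_mul]
    gcongr
    exact norm_add_le _ _
  zero_mem' := fun t _ => by simp
  smul_mem' := fun c x hx t ht => by
    have h := (hx t ht).const_mul ‖c‖
    rw [mul_zero] at h
    refine h.congr fun n => ?_
    simp only [Pi.smul_apply, norm_smul]
    ring

/-- The power series space `C_{0,r}(α)` of order `0` and finite type `r`, again as a type of its
own. -/
def PowerSeriesSpaceZero (𝕜 : Type*) [RCLike 𝕜] (r : ℝ) (α : ℕ → ℝ) : Type _ :=
  zeroSubmodule 𝕜 r α

namespace PowerSeriesSpaceZero

variable {𝕜 : Type*} [RCLike 𝕜] {r : ℝ} {α : ℕ → ℝ}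

instance : AddCommGroup (PowerSeriesSpaceZero 𝕜 r α) :=
  inferInstanceAs (AddCommGroup (zeroSubmodule 𝕜 r α))

instance : Module 𝕜 (PowerSeriesSpaceZero 𝕜 r α) :=
  inferInstanceAs (Module 𝕜 (zeroSubmodule 𝕜 r α))

/-- The sequence of coordinates of an element. -/
def coord (𝕜 : Type*) [RCLike 𝕜] (r : ℝ) (α : ℕ → ℝ) :
    PowerSeriesSpaceZero 𝕜 r α →ₗ[𝕜] (ℕ → 𝕜) :=
  (zeroSubmodule 𝕜 r α).subtype

theorem coord_mem (x : PowerSeriesSpaceZero 𝕜 r α) (t : ℝ) (ht : t < r) :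
    Tendsto (fun n => ‖coord 𝕜 r α x n‖ * Real.exp (t * α n)) atTop (𝓝 0) :=
  x.2 t ht

/-- The seminorms `‖x‖_t = sup_n |x_n| e^{t α_n}`, for `t < r`. -/
def seminorms (𝕜 : Type*) [RCLike 𝕜] (r : ℝ) (α : ℕ → ℝ) :
    SeminormFamily 𝕜 (PowerSeriesSpaceZero 𝕜 r α) (Set.Iio r) := fun t =>
  Seminorm.of
    (fun x => ⨆ n, ‖coord 𝕜 r α x n‖ * Real.exp ((t : ℝ) * α n))
    (fun x y => by
      refine ciSup_le fun n => ?_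
      have hx := le_ciSup (coord_mem x t t.2).bddAbove_range n
      have hy := le_ciSup (coord_mem y t t.2).bddAbove_range n
      refine le_trans ?_ (add_le_add hx hy)
      rw [← add_mul, map_add, Pi.add_apply]
      gcongr
      exact norm_add_le _ _)
    (fun c x => by
      rw [Real.mul_iSup_of_nonneg (norm_nonneg c)]
      refine iSup_congr fun n => ?_
      rw [map_smul, Pi.smul_apply, norm_smul, mul_assoc])

/-- The locally convex topology generated by the seminorms. -/
instance : TopologicalSpace (PowerSeriesSpaceZero 𝕜 r α) :=
  (seminorms 𝕜 r α).moduleFilterBasis.topology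

theorem withSeminorms : WithSeminorms (seminorms 𝕜 r α) := ⟨rfl⟩

end PowerSeriesSpaceZero

/-! ### Weighted shifts and linear dynamics -/

/-- `T` is, in the coordinates `c`, a weighted backward shift
`(x_n)_n ↦ (w_{n+1} x_{n+1})_n` with non-zero weights. -/
def IsWeightedShift {𝕜 X : Type*} [RCLike 𝕜] [AddCommGroup X] [Module 𝕜 X] [TopologicalSpace X]
    (c : X →ₗ[𝕜] (ℕ → 𝕜)) (T : X →L[𝕜] X) : Prop :=
  ∃ w : ℕ → 𝕜, (∀ n, w n ≠ 0) ∧ ∀ x n, c (T x) n = w (n + 1) * c x (n + 1)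

/-- `T` has a dense orbit. -/
def IsHypercyclic {X : Type*} [TopologicalSpace X] (T : X → X) : Prop :=
  ∃ x, Dense (Set.range fun n : ℕ => T^[n] x)

/-- `T` is hypercyclic and has a dense set of periodic points. -/
def IsChaotic {X : Type*} [TopologicalSpace X] (T : X → X) : Prop :=
  IsHypercyclic T ∧ Dense (Function.periodicPts T)

open Classical in
/-- The lower asymptotic density `liminf_N card {n ≤ N : n ∈ A} / (N + 1)`. -/
def lowerDensity (A : Set ℕ) : ℝ :=
  liminf (fun N : ℕ => (((Finset.range (N + 1)).filter (· ∈ A)).card : ℝ) / (N + 1)) atTop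

/-- Some orbit visits every non-empty open set along a set of times of positive lower density. -/
def IsFrequentlyHypercyclic {X : Type*} [TopologicalSpace X] (T : X → X) : Prop :=
  ∃ x, ∀ U : Set X, IsOpen U → U.Nonempty → 0 < lowerDensity {n | T^[n] x ∈ U}

end

/-! Both kinds of space become weighted sup-spaces. For order `p`, the summability hypothesis makes
`∑ exp (-s α_n)` finite for all `s > 0`, so passing between weighted `ℓ^p`- and sup-norms costs only
an arbitrarily small loss in the exponent; the type becomes `ρ = r / p`
(`PowerSeriesSpace.isWeightedSupSpace`). The growth hypotheses reduce to `α (n + 1) ≤ M α n`, and,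
for each `K`, `K α n ≤ α (n + j)` eventually, for some `j`.

Take weights `v n / v (n + 1)`, so that `v` is formally a fixed vector, with `v n = exp (-ρ α n + b
n)`. If `b` is monotone, the bound `M` makes the shift continuous. With `b = 0` the vector `v` lies
in the space, and so do its products with periodic sequences; these supply the periodic points.

For the shift that is not chaotic, `b n = α (Q i)`, where `Q i` is the last member of a very sparse
sequence not exceeding `n`. A vector of period `N` is proportional to `v` along the multiples of
`N`, unless its zeroth coordinate vanishes. One such multiple lies within `N` steps after each `Q
i`, where `v` is still too large for the space (`not_dense_periodicPts`). Once `κ s` steps have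
passed since the last `Q i`, the fast growth of `α` makes `v` small again (`exists_delay`).

Frequent hypercyclicity uses this smallness: the vector is `v` times a sequence of blocks, the
`p`-th block being repeated at the positions in a set `A p` of positive lower density. The
differences of these positions must avoid the stretches after the `Q i`. This is arranged
arithmetically by `sparseMultiples` and `farBeyond_sub`. The case `b = 0` satisfies the same
estimates, so it is hypercyclic as well. -/

/-! ### Arithmetic of sparse sets whose differences avoid the stretches after the `Q i`. -/

theorem exists_rapid_powers_of_three (κ : ℕ → ℕ) : ∃ a : ℕ → ℕ, StrictMono a ∧
    2 * (κ 0 + 1) ≤ 3 ^ a 0 ∧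
    ∀ q, 32 * 2 ^ (q + 1) * (κ (q + 1) + q + 2 + 3 ^ a q) * 3 ^ a q ≤ 3 ^ a (q + 1) := by
  let F : ℕ → ℕ → ℕ := fun q x => x + 32 * 2 ^ (q + 1) * (κ (q + 1) + q + 2 + 3 ^ x)
  let a : ℕ → ℕ := fun n => Nat.rec (2 * (κ 0 + 1)) F n
  have ha : ∀ q, a (q + 1) = a q + 32 * 2 ^ (q + 1) * (κ (q + 1) + q + 2 + 3 ^ a q) := fun q => rfl
  refine ⟨a, strictMono_nat_of_lt_succ fun q => ?_, ?_, fun q => ?_⟩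
  · rw [ha]
    have : 0 < 32 * 2 ^ (q + 1) * (κ (q + 1) + q + 2 + 3 ^ a q) := by positivity
    omega
  · exact (Nat.lt_pow_self (by norm_num)).le
  · rw [ha, pow_add 3, mul_comm (3 ^ a q)]
    exact Nat.mul_le_mul_right _ (Nat.lt_pow_self (by norm_num)).le

/-- `k` comes at least `K` steps after `0` and after the last element of `range Q` below it. -/
def FarBeyond (Q : ℕ → ℕ) (K k : ℕ) : Prop :=
  K ≤ k ∧ ∀ i, Q i ≤ k → Q i + K ≤ k

/-- The growth conditions under which the sets `sparseMultiples` have the required properties. -/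
structure RapidGrowth (κ Q g : ℕ → ℕ) : Prop where
  pos : ∀ q, 0 < Q q
  odd_multiple : ∀ s i, s ≤ i → ∃ c, Q i = (2 * c + 1) * Q s
  gap_ge : ∀ s, κ s + s + 1 ≤ g s
  gap_ge' : ∀ s i, i < s → κ s + s + 1 + Q i ≤ g s
  two_gap_le : ∀ s, 2 * g s ≤ Q s
  growth : ∀ p q, p < q → 32 * 2 ^ q * g q * Q p ≤ Q q

/-- Powers of three serve because their quotients are odd: every later `Q i` is then at distance at
least `Q s` from every multiple of `2 * Q s`. The gap includes the preceding `Q`, so that it clears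
all earlier members. -/
theorem exists_rapidGrowth (κ : ℕ → ℕ) : ∃ Q g : ℕ → ℕ, StrictMono Q ∧ RapidGrowth κ Q g := by
  obtain ⟨a, ha, h0, h⟩ := exists_rapid_powers_of_three κ
  have hQ : StrictMono fun q => 3 ^ a q := fun i j hij =>
    Nat.pow_lt_pow_right (by norm_num) (ha hij)
  have hle : ∀ i q, i < q + 1 → 3 ^ a i ≤ 3 ^ a q := fun i q hi => hQ.monotone (by omega)
  have hpos : ∀ q, 0 < 3 ^ a q := fun q => by positivity
  refine ⟨fun q => 3 ^ a q,
    fun q => Nat.casesOn q (κ 0 + 1) fun q => κ (q + 1) + q + 2 + 3 ^ a q, hQ, ?_⟩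
  constructor
  · exact hpos
  · intro s i hsi
    have h1 : Odd (3 ^ (a i - a s)) := Odd.pow (by decide)
    obtain ⟨c, hc⟩ := h1
    refine ⟨c, ?_⟩
    rw [← hc, ← pow_add, Nat.sub_add_cancel (ha.monotone hsi)]
  · rintro (_ | s)
    · simp
    · have := hpos s
      simp only
      omega
  · rintro (_ | s) i hi
    · omega
    · have := hle i s hi
      simp only
      omega
  · rintro (_ | s)
    · exact h0
    · refine le_trans ?_ (h s)
      have h1 : 1 ≤ 2 ^ (s + 1) := Nat.one_le_two_pow
      have h2 := hpos s
      simp only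
      generalize κ (s + 1) + s + 2 + 3 ^ a s = y
      calc 2 * y = 2 * 1 * y * 1 := by ring
        _ ≤ 32 * 2 ^ (s + 1) * y * 3 ^ a s := by gcongr <;> omega
  · rintro p (_ | s) hp
    · omega
    · refine le_trans ?_ (h s)
      have := hle p s hp
      simp only
      gcongr

/-- Multiples of `2 * Q p` keeping a distance `g q` from the non-zero multiples of `Q q`, for all
`q > p`. -/
def sparseMultiples (Q g : ℕ → ℕ) (p : ℕ) : Set ℕ :=
  {n | 0 < n ∧ 2 * Q p ∣ n ∧
    ∀ q, p < q → Q q ≤ 2 * n → g q ≤ n % Q q ∧ n % Q q + g q ≤ Q q}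

namespace RapidGrowth

variable {κ Q g : ℕ → ℕ}

/-- Every `Q i` with `i ≥ s` is a multiple of `Q s`, and `x` is at least `g s` beyond the last such
multiple; the room above keeps `x + h` from reaching the next one. The earlier `Q i` are cleared
because `x ≥ g s`. -/
theorem farBeyond_of_mod (H : RapidGrowth κ Q g) {s x h : ℕ} (hs : h ≤ s)
    (h1 : g s ≤ x % Q s) (h2 : x % Q s + g s ≤ Q s) : FarBeyond Q (κ s) (x + h) := by
  have hg := H.gap_ge s
  have hx := Nat.div_add_mod x (Q s)
  have hlx := Nat.mod_le x (Q s)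
  refine ⟨by omega, fun i hi => ?_⟩
  rcases lt_or_ge i s with his | his
  · have := H.gap_ge' s i his
    omega
  · obtain ⟨c, hc⟩ := H.odd_multiple s i his
    rw [hc] at hi ⊢
    have hlt : (2 * c + 1) * Q s < (x / Q s + 1) * Q s := by
      calc (2 * c + 1) * Q s ≤ x + h := hi
        _ < (x / Q s + 1) * Q s := by rw [add_mul, mul_comm (x / Q s)]; omega
    have hle : 2 * c + 1 ≤ x / Q s := Nat.lt_succ_iff.mp (lt_of_mul_lt_mul_right' hlt)
    have := Nat.mul_le_mul_right (Q s) hle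
    rw [mul_comm (x / Q s)] at this
    omega

/-- A parity argument: for `i ≥ s` the number `Q i` is an odd multiple of `Q s`, whereas `x + m` is
an even one. An odd multiple not exceeding `x + h` is therefore at most `x + m - Q s`, which lies
more than `Q s / 2 ≥ g s` below `x`. -/
theorem farBeyond_of_dvd_add (H : RapidGrowth κ Q g) {s x m h : ℕ} (hs : h ≤ s)
    (hpos : 0 < x + m) (hdvd : 2 * Q s ∣ x + m) (hm : 2 * m < Q s) :
    FarBeyond Q (κ s) (x + h) := by
  have hg := H.gap_ge s
  have hgQ := H.two_gap_le s
  have hle := Nat.le_of_dvd hpos hdvd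
  refine ⟨by omega, fun i hi => ?_⟩
  rcases lt_or_ge i s with his | his
  · have := H.gap_ge' s i his
    omega
  · obtain ⟨c, hc⟩ := H.odd_multiple s i his
    obtain ⟨e, he⟩ := hdvd
    rw [hc] at hi ⊢
    have hlt : (2 * c + 1) * Q s < (2 * e + 1) * Q s := by
      have : (2 * e + 1) * Q s = 2 * Q s * e + Q s := by ring
      omega
    have hlt' : 2 * c + 1 < 2 * e + 1 := lt_of_mul_lt_mul_right' hlt
    have h3 : 2 * c + 2 ≤ 2 * e := by omega
    have h4 := Nat.mul_le_mul_right (Q s) h3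
    have h5 : (2 * c + 2) * Q s = (2 * c + 1) * Q s + Q s := by ring
    have h6 : 2 * e * Q s = 2 * Q s * e := by ring
    omega

/-- Work modulo the larger of `Q p`, `Q q`. If `p < q`, subtracting `m` does not change the residue
of `n`, which avoids the gap; if `p = q`, parity decides. If `p > q`, parity still decides for small
`m`, and otherwise the residue of `n - m` is the reflection of that of `m`. -/
theorem farBeyond_sub (H : RapidGrowth κ Q g) {p q n m h : ℕ}
    (hn : n ∈ sparseMultiples Q g p) (hm : m ∈ sparseMultiples Q g q) (hmn : m < n)
    (hh : h ≤ p) : FarBeyond Q (κ (max p q)) (n - m + h) := by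
  obtain ⟨n0, nd, nq⟩ := hn
  obtain ⟨m0, md, mq⟩ := hm
  have hsum : n - m + m = n := Nat.sub_add_cancel hmn.le
  rcases lt_trichotomy p q with hpq | rfl | hpq
  · rw [max_eq_right hpq.le]
    have hmQ := Nat.le_of_dvd m0 md
    have key := nq q hpq (by omega)
    have hmod : (n - m) % Q q = n % Q q := by
      obtain ⟨c, hc⟩ := (Dvd.intro_left 2 rfl : Q q ∣ 2 * Q q).trans md
      conv_rhs => rw [← hsum, hc, Nat.add_mul_mod_self_left]
      rw [hc]
    rw [← hmod] at key
    exact H.farBeyond_of_mod (by omega) key.1 key.2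
  · rw [max_self]
    exact H.farBeyond_of_dvd_add (m := 0) hh (by omega) (by simpa using Nat.dvd_sub nd md)
      (by have := H.pos p; omega)
  · rw [max_eq_left hpq.le]
    rcases lt_or_ge (2 * m) (Q p) with hlt | hge
    · exact H.farBeyond_of_dvd_add hh (by omega) (by rwa [hsum]) hlt
    · have key := mq p hpq hge
      have hg := H.gap_ge p
      have hmod : (n - m) % Q p = Q p - m % Q p := by
        have hd : Q p ∣ n := (Dvd.intro_left 2 rfl : Q p ∣ 2 * Q p).trans nd
        have h1 : Q p ∣ (n - m) % Q p + m % Q p := by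
          rw [Nat.dvd_iff_mod_eq_zero, ← Nat.add_mod, hsum]
          exact Nat.mod_eq_zero_of_dvd hd
        have h2 := Nat.mod_lt (n - m) (H.pos p)
        have h3 := Nat.mod_lt m (H.pos p)
        obtain ⟨c, hc⟩ := h1
        -- The two residues add up to a multiple of `Q p` below `2 * Q p`, which is non-zero because
        -- `m % Q p ≥ g p > 0`.
        have hc1 : c = 1 := by
          have hlt : Q p * c < Q p * 2 := by omega
          have := lt_of_mul_lt_mul_left' hlt
          have : c ≠ 0 := by
            rintro rfl
            omega
          omega
        rw [hc1] at hc
        omega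
      exact H.farBeyond_of_mod hh (by omega) (by omega)

/-- The analogue of `farBeyond_sub` with `m = 0`; it shows that the vector built from blocks belongs
to the space. -/
theorem farBeyond_add (H : RapidGrowth κ Q g) {p q n h : ℕ}
    (hn : n ∈ sparseMultiples Q g p) (hq : 2 * Q q ≤ n) (hh : h ≤ p) :
    FarBeyond Q (κ (max p q)) (n + h) := by
  obtain ⟨n0, nd, nq⟩ := hn
  rcases lt_or_ge p q with hpq | hpq
  · rw [max_eq_right hpq.le]
    have key := nq q hpq (by omega)
    exact H.farBeyond_of_mod (by omega) key.1 key.2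
  · rw [max_eq_left hpq]
    exact H.farBeyond_of_dvd_add (m := 0) hh (by omega) (by simpa using nd)
      (by have := H.pos p; omega)

theorem index_unique (H : RapidGrowth κ Q g) {p q n : ℕ}
    (hn : n ∈ sparseMultiples Q g p) (hm : n ∈ sparseMultiples Q g q) : p = q := by
  by_contra hne
  wlog hpq : p < q generalizing p q
  · exact this hm hn (Ne.symm hne) (by omega)
  have hd : Q q ∣ n := (Dvd.intro_left 2 rfl : Q q ∣ 2 * Q q).trans hm.2.1
  have := (hn.2.2 q hpq (by have := Nat.le_of_dvd hm.1 hd; omega)).1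
  rw [Nat.mod_eq_zero_of_dvd hd] at this
  have := H.gap_ge q
  omega

open Classical in
-- Each excluded `n` is `c * Q q + d - g q` with `d < 2 * g q`. Here `c ≥ 1`, and `c * Q q ≤ n + g q
-- ≤ 2 * n` because `2 * g q ≤ Q q ≤ 2 * n`.
theorem card_excluded_le (H : RapidGrowth κ Q g) (X q : ℕ) :
    ((Finset.Icc 1 X).filter fun n => Q q ≤ 2 * n ∧
      ¬ (g q ≤ n % Q q ∧ n % Q q + g q ≤ Q q)).card ≤ (2 * X / Q q) * (2 * g q) := by
  have hsub : ((Finset.Icc 1 X).filter fun n => Q q ≤ 2 * n ∧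
      ¬ (g q ≤ n % Q q ∧ n % Q q + g q ≤ Q q)) ⊆
      (Finset.Icc 1 (2 * X / Q q) ×ˢ Finset.range (2 * g q)).image
        fun cd => cd.1 * Q q + cd.2 - g q := by
    intro n hn
    simp only [Finset.mem_filter, Finset.mem_Icc] at hn
    obtain ⟨⟨-, hnX⟩, hQn, hbad⟩ := hn
    have hmod := Nat.div_add_mod n (Q q)
    have hlt := Nat.mod_lt n (H.pos q)
    have hg := H.two_gap_le q
    simp only [Finset.mem_image, Finset.mem_product, Finset.mem_Icc, Finset.mem_range, Prod.exists]
    by_cases h1 : g q ≤ n % Q q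
    · refine ⟨n / Q q + 1, n % Q q + g q - Q q, ⟨⟨Nat.succ_pos _, ?_⟩, by omega⟩, ?_⟩
      · rw [Nat.le_div_iff_mul_le (H.pos q), add_mul, mul_comm]
        omega
      · rw [add_mul, mul_comm]
        omega
    · refine ⟨n / Q q, n % Q q + g q, ⟨⟨?_, ?_⟩, by omega⟩, ?_⟩
      · rw [Nat.one_le_div_iff (H.pos q)]
        by_contra hc
        rw [Nat.mod_eq_of_lt (by omega)] at h1
        omega
      · rw [Nat.le_div_iff_mul_le (H.pos q), mul_comm]
        omega
      · rw [mul_comm]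
        omega
  refine (Finset.card_le_card hsub).trans (Finset.card_image_le.trans ?_)
  simp

open Classical in
theorem card_sparseMultiples_ge (H : RapidGrowth κ Q g) (hQ : StrictMono Q) (p X : ℕ) :
    (X : ℝ) / (4 * Q p) - 1 ≤
      (((Finset.range (X + 1)).filter (· ∈ sparseMultiples Q g p)).card : ℝ) := by
  set E : ℕ → Finset ℕ := fun q => (Finset.Icc 1 X).filter fun n => Q q ≤ 2 * n ∧
      ¬ (g q ≤ n % Q q ∧ n % Q q + g q ≤ Q q) with hE
  set A := (Finset.range (X + 1)).filter (· ∈ sparseMultiples Q g p) with hA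
  have hcover : (Finset.Ioc 0 X).filter (2 * Q p ∣ ·) ⊆
      A ∪ (Finset.Ioc p (2 * X)).biUnion E := by
    intro n hn
    simp only [Finset.mem_filter, Finset.mem_Ioc] at hn
    obtain ⟨⟨hn0, hnX⟩, hd⟩ := hn
    by_cases hnA : n ∈ sparseMultiples Q g p
    · exact Finset.mem_union_left _ (Finset.mem_filter.mpr ⟨by simp; omega, hnA⟩)
    · refine Finset.mem_union_right _ ?_
      simp only [sparseMultiples, Set.mem_ofPred_eq, not_and, not_forall] at hnA
      obtain ⟨q, hpq, hQn, hbad⟩ := hnA hn0 hd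
      -- As `q ≤ Q q ≤ 2 * n ≤ 2 * X`, only finitely many `q` exclude anything up to `X`.
      have hqQ := hQ.id_le q
      simp only [id] at hqQ
      refine Finset.mem_biUnion.mpr ⟨q, by simp; omega, ?_⟩
      simp only [hE, Finset.mem_filter, Finset.mem_Icc, not_and]
      exact ⟨⟨hn0, hnX⟩, hQn, hbad⟩
  have hcard := (Finset.card_le_card hcover).trans
    ((Finset.card_union_le _ _).trans (Nat.add_le_add_left Finset.card_biUnion_le _))
  rw [Nat.Ioc_filter_dvd_card_eq_div] at hcard
  have hcardR : ((X / (2 * Q p) : ℕ) : ℝ) ≤ A.card + ∑ q ∈ Finset.Ioc p (2 * X), ((E q).card : ℝ) := by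
    exact_mod_cast hcard
  have hP : (0 : ℝ) < Q p := by exact_mod_cast H.pos p
  have hE1 : ∀ q ∈ Finset.Ioc p (2 * X), ((E q).card : ℝ) ≤ X / (8 * Q p) * (1 / 2) ^ q := by
    intro q hq
    have hpq : p < q := (Finset.mem_Ioc.mp hq).1
    have hq0 : (0 : ℝ) < Q q := by exact_mod_cast H.pos q
    have h1 : ((E q).card : ℝ) ≤ ((2 * X / Q q : ℕ) : ℝ) * (2 * g q) := by
      exact_mod_cast H.card_excluded_le X q
    have h2 : ((2 * X / Q q : ℕ) : ℝ) ≤ 2 * X / Q q := by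
      refine Nat.cast_div_le.trans (le_of_eq ?_)
      push_cast
      rfl
    have h3 : (32 * 2 ^ q * g q * Q p : ℝ) ≤ Q q := by exact_mod_cast H.growth p q hpq
    refine h1.trans ((mul_le_mul_of_nonneg_right h2 (by positivity)).trans ?_)
    rw [one_div, inv_pow, div_mul_eq_mul_div, ← div_eq_mul_inv, div_div, div_le_div_iff₀ hq0 (by positivity)]
    have h4 := mul_le_mul_of_nonneg_left h3 (Nat.cast_nonneg X)
    linarith
  -- The exclusions remove at most half of the roughly `X / (2 * Q p)` multiples of `2 * Q p`.
  have hE2 : ∑ q ∈ Finset.Ioc p (2 * X), ((E q).card : ℝ) ≤ X / (4 * Q p) := by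
    refine (Finset.sum_le_sum hE1).trans ?_
    rw [← Finset.mul_sum]
    have h2 : ∑ q ∈ Finset.Ioc p (2 * X), ((1 : ℝ) / 2) ^ q ≤ 2 := by
      exact (summable_geometric_two.sum_le_tsum _ fun i _ => by positivity).trans
        tsum_geometric_two.le
    refine (mul_le_mul_of_nonneg_left h2 (by positivity)).trans (le_of_eq ?_)
    ring
  have hfl : (X : ℝ) / (2 * Q p) - 1 ≤ ((X / (2 * Q p) : ℕ) : ℝ) := by
    have := Nat.lt_floor_add_one ((X : ℝ) / ((2 * Q p : ℕ) : ℝ))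
    rw [Nat.floor_div_eq_div] at this
    push_cast at this ⊢
    linarith
  have hsplit : (X : ℝ) / (2 * Q p) = X / (4 * Q p) + X / (4 * Q p) := by
    ring
  linarith

end RapidGrowth

/-! ### Lower density. -/

theorem lowerDensity_pos_of_le {A : Set ℕ} {c : ℝ} (hc : 0 < c)
    (h : ∀ X : ℕ, open Classical in
      c * X - 1 ≤ (((Finset.range (X + 1)).filter (· ∈ A)).card : ℝ)) :
    0 < lowerDensity A := by
  classical
  have hev : ∀ᶠ N : ℕ in atTop, c / 2 ≤
      (((Finset.range (N + 1)).filter (· ∈ A)).card : ℝ) / (N + 1) := by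
    filter_upwards [(tendsto_natCast_atTop_atTop (R := ℝ)).eventually_ge_atTop (1 + 2 / c)] with N hN
    rw [le_div_iff₀ (by positivity)]
    refine le_trans ?_ (by convert h N)
    have h1 : c * (1 + 2 / c) ≤ c * N := mul_le_mul_of_nonneg_left hN hc.le
    have h2 : c * (1 + 2 / c) = c + 2 := by field_simp
    linarith
  refine lt_of_lt_of_le (half_pos hc) ?_
  unfold lowerDensity
  refine le_liminf_of_le (IsBoundedUnder.isCoboundedUnder_ge ⟨1, ?_⟩) (by convert hev)
  rw [eventually_map]
  refine Eventually.of_forall fun N => (div_le_one (by positivity)).mpr ?_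
  have := Finset.card_filter_le (Finset.range (N + 1)) (· ∈ A)
  rw [Finset.card_range] at this
  exact_mod_cast this

theorem lowerDensity_pos_mono {A B : Set ℕ} (hAB : A ⊆ B) (h : 0 < lowerDensity A) :
    0 < lowerDensity B := by
  refine h.trans_le ?_
  unfold lowerDensity
  refine liminf_le_liminf (Eventually.of_forall fun N => ?_) ?_ ?_
  · gcongr
  · exact ⟨0, eventually_map.mpr (Eventually.of_forall fun N => by positivity)⟩
  · refine IsBoundedUnder.isCoboundedUnder_ge ⟨1, eventually_map.mpr (Eventually.of_forall fun N =>
      (div_le_one (by positivity)).mpr ?_)⟩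
    classical
    have := Finset.card_filter_le (Finset.range (N + 1)) (· ∈ B)
    rw [Finset.card_range] at this
    exact_mod_cast this

theorem RapidGrowth.lowerDensity_pos {κ Q g : ℕ → ℕ} (H : RapidGrowth κ Q g) (hQ : StrictMono Q)
    (p : ℕ) : 0 < lowerDensity (sparseMultiples Q g p) := by
  have hP : (0 : ℝ) < Q p := by exact_mod_cast H.pos p
  refine lowerDensity_pos_of_le (c := 1 / (4 * Q p)) (by positivity) fun X => ?_
  rw [one_div_mul_eq_div]
  exact H.card_sparseMultiples_ge hQ p X

theorem lowerDensity_empty : lowerDensity ∅ = 0 := by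
  simp [lowerDensity]

/-! ### Weighted sup-spaces and sequences assembled from blocks. -/

/-- In the coordinates `c`, `X` is the space of all `x` with `|x_n| e^{t α_n} → 0` for `t < ρ`, and
its topology is given by the corresponding weighted sup-norms. -/
structure IsWeightedSupSpace {𝕜 X : Type*} [RCLike 𝕜] [AddCommGroup X] [Module 𝕜 X]
    [TopologicalSpace X] (c : X →ₗ[𝕜] (ℕ → 𝕜)) (α : ℕ → ℝ) (ρ : ℝ) : Prop where
  injective : Function.Injective c
  mem_range : ∀ x : ℕ → 𝕜, (∃ y, c y = x) ↔
    ∀ t < ρ, Tendsto (fun n => ‖x n‖ * Real.exp (t * α n)) atTop (𝓝 0)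
  mem_nhds : ∀ (x : X) (U : Set X), U ∈ 𝓝 x ↔ ∃ t < ρ, ∃ ε > 0,
    ∀ y, (∀ n, ‖c y n - c x n‖ * Real.exp (t * α n) ≤ ε) → y ∈ U

/-- The first half of `q`, unpaired, codes a list of indices into a dense sequence. The second half
is free, so each list recurs for arbitrarily large `q`, at which the cut-offs of length and size by
`q` no longer affect it. -/
theorem exists_dense_blocks (𝕜 : Type*) [RCLike 𝕜] : ∃ f : ℕ → ℕ → 𝕜,
    (∀ q k, q ≤ k → f q k = 0) ∧ (∀ q k, ‖f q k‖ ≤ q) ∧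
    ∀ (g : ℕ → 𝕜) (K : ℕ) (η : ℝ), 0 < η → ∀ q₀, ∃ q ≥ q₀,
      (∀ k < K, ‖f q k - g k‖ < η) ∧ ∀ k, K ≤ k → f q k = 0 := by
  classical
  let e : ℕ → ℕ → 𝕜 := fun q k =>
    (((Encodable.decode (α := List ℕ) q.unpair.1).getD []).map (TopologicalSpace.denseSeq 𝕜)).getD k 0
  refine ⟨fun q k => if k < q ∧ ‖e q k‖ ≤ q then e q k else 0, fun q k hk => ?_, fun q k => ?_,
    fun g K η hη q₀ => ?_⟩
  · exact if_neg (by omega)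
  · simp only
    split_ifs with h
    · exact h.2
    · simp
  · have hd : ∀ k, ∃ i, ‖TopologicalSpace.denseSeq 𝕜 i - g k‖ < η := by
      intro k
      obtain ⟨y, hy, i, rfl⟩ := Metric.dense_iff.mp (TopologicalSpace.denseRange_denseSeq 𝕜) (g k) η hη
      exact ⟨i, by simpa [dist_eq_norm] using hy⟩
    choose i hi using hd
    let l : List ℕ := (List.range K).map i
    let u : ℕ → 𝕜 := fun k => if k < K then TopologicalSpace.denseSeq 𝕜 (i k) else 0
    obtain ⟨B, hB⟩ : ∃ B : ℕ, ∀ k, ‖u k‖ ≤ B := by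
      obtain ⟨B, hB⟩ := exists_nat_ge (∑ k ∈ Finset.range K, ‖TopologicalSpace.denseSeq 𝕜 (i k)‖)
      refine ⟨B, fun k => ?_⟩
      simp only [u]
      split_ifs with hk
      · exact (Finset.single_le_sum (f := fun k => ‖TopologicalSpace.denseSeq 𝕜 (i k)‖)
          (fun _ _ => norm_nonneg _) (Finset.mem_range.mpr hk)).trans hB
      · simp
    have he : ∀ j k, e (Nat.pair (Encodable.encode l) j) k = u k := by
      intro j k
      simp only [e, u, Nat.unpair_pair, Encodable.encodek, Option.getD_some, l, List.map_map]
      by_cases hk : k < K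
      · simp [hk]
      · simp [hk]
    have hq := Nat.right_le_pair (Encodable.encode l) (q₀ + K + B)
    refine ⟨Nat.pair (Encodable.encode l) (q₀ + K + B), by omega, fun k hk => ?_, fun k hk => ?_⟩
    · simp only [he]
      rw [if_pos]
      · simpa [u, hk] using hi k
      · refine ⟨by omega, (hB k).trans ?_⟩
        exact_mod_cast (by omega : B ≤ Nat.pair (Encodable.encode l) (q₀ + K + B))
    · simp only [he]
      simp [u, not_lt.mpr hk]

theorem exists_block_sequence {R : Type*} [Zero R] (A : ℕ → Set ℕ) (f : ℕ → ℕ → R)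
    (hA : ∀ p q n m h h', n ∈ A p → m ∈ A q → h < p → h' < q → n + h = m + h' → n = m ∧ p = q) :
    ∃ z : ℕ → R, (∀ p n h, n ∈ A p → h < p → z (n + h) = f p h) ∧
      ∀ k, z k = 0 ∨ ∃ p n h, n ∈ A p ∧ h < p ∧ k = n + h ∧ z k = f p h := by
  classical
  let P : ℕ → ℕ × ℕ × ℕ → Prop := fun k x => x.2.1 ∈ A x.1 ∧ x.2.2 < x.1 ∧ k = x.2.1 + x.2.2
  let z : ℕ → R := fun k => if h : ∃ x, P k x then f h.choose.1 h.choose.2.2 else 0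
  refine ⟨z, fun p n h hn hh => ?_, fun k => ?_⟩
  · have hex : ∃ x, P (n + h) x := ⟨(p, n, h), hn, hh, rfl⟩
    obtain ⟨h1, h2, h3⟩ := hex.choose_spec
    obtain ⟨h4, h5⟩ := hA _ _ _ _ _ _ hn h1 hh h2 h3
    have h6 : hex.choose.2.2 = h := by omega
    simp only [z]
    rw [dif_pos hex, ← h5, h6]
  · by_cases hex : ∃ x, P k x
    · obtain ⟨h1, h2, h3⟩ := hex.choose_spec
      exact Or.inr ⟨_, _, _, h1, h2, h3, by simp only [z]; rw [dif_pos hex]⟩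
    · left
      simp only [z]
      rw [dif_neg hex]

theorem IsFrequentlyHypercyclic.isHypercyclic {X : Type*} [TopologicalSpace X] {T : X → X}
    (h : IsFrequentlyHypercyclic T) : IsHypercyclic T := by
  obtain ⟨x, hx⟩ := h
  refine ⟨x, dense_iff_inter_open.mpr fun U hU hne => ?_⟩
  have hpos := hx U hU hne
  rcases Set.eq_empty_or_nonempty {n | T^[n] x ∈ U} with he | ⟨n, hn⟩
  · rw [he, lowerDensity_empty] at hpos
    exact absurd hpos (lt_irrefl _)
  · exact ⟨_, hn, n, rfl⟩

/-! ### Dynamics of the shift with weights `v n / v (n + 1)`. -/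

namespace IsWeightedSupSpace

theorem iterate_apply {𝕜 X : Type*} [RCLike 𝕜] [AddCommGroup X] [Module 𝕜 X]
    {c : X →ₗ[𝕜] (ℕ → 𝕜)} {v : ℕ → ℝ} (hv : ∀ n, 0 < v n) {T : X → X}
    (hT : ∀ x n, c (T x) n = ((v n / v (n + 1) : ℝ) : 𝕜) * c x (n + 1)) (m : ℕ) (x : X) (n : ℕ) :
    c (T^[m] x) n = ((v n / v (n + m) : ℝ) : 𝕜) * c x (n + m) := by
  induction m generalizing x with
  | zero => simp [div_self (hv n).ne']
  | succ m ih =>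
    rw [Function.iterate_succ_apply, ih, hT, ← mul_assoc, ← RCLike.ofReal_mul,
      div_mul_div_cancel₀ (hv _).ne', add_assoc]

variable {𝕜 X : Type*} [RCLike 𝕜] [AddCommGroup X] [Module 𝕜 X]
    [TopologicalSpace X] {c : X →ₗ[𝕜] (ℕ → 𝕜)} {α : ℕ → ℝ} {ρ : ℝ}

theorem tendsto (H : IsWeightedSupSpace c α ρ) (x : X) {t : ℝ} (ht : t < ρ) :
    Tendsto (fun n => ‖c x n‖ * Real.exp (t * α n)) atTop (𝓝 0) :=
  (H.mem_range _).mp ⟨x, rfl⟩ t ht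

theorem exists_shift (H : IsWeightedSupSpace c α ρ) {v : ℕ → ℝ} (hv : ∀ n, 0 < v n)
    (hcont : ∀ t < ρ, ∃ s < ρ, ∀ n, v n / v (n + 1) * Real.exp (t * α n) ≤
      Real.exp (s * α (n + 1))) :
    ∃ T : X →L[𝕜] X, IsWeightedShift c T ∧
      ∀ x n, c (T x) n = ((v n / v (n + 1) : ℝ) : 𝕜) * c x (n + 1) := by
  have hnorm : ∀ n (a : 𝕜), ‖((v n / v (n + 1) : ℝ) : 𝕜) * a‖ = v n / v (n + 1) * ‖a‖ := by
    intro n a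
    rw [norm_mul, RCLike.norm_ofReal, abs_of_pos (div_pos (hv _) (hv _))]
  have hle : ∀ t < ρ, ∃ s < ρ, ∀ n (a : 𝕜), ‖((v n / v (n + 1) : ℝ) : 𝕜) * a‖ *
      Real.exp (t * α n) ≤ ‖a‖ * Real.exp (s * α (n + 1)) := by
    intro t ht
    obtain ⟨s, hs, h⟩ := hcont t ht
    refine ⟨s, hs, fun n a => ?_⟩
    rw [hnorm]
    calc v n / v (n + 1) * ‖a‖ * Real.exp (t * α n)
        = ‖a‖ * (v n / v (n + 1) * Real.exp (t * α n)) := by ring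
      _ ≤ _ := mul_le_mul_of_nonneg_left (h n) (norm_nonneg _)
  have hex : ∀ x : X, ∃ y, c y = fun n => ((v n / v (n + 1) : ℝ) : 𝕜) * c x (n + 1) := by
    intro x
    rw [H.mem_range]
    intro t ht
    obtain ⟨s, hs, h⟩ := hle t ht
    exact squeeze_zero (fun n => by positivity) (fun n => h n _)
      ((H.tendsto x hs).comp (tendsto_add_atTop_nat 1))
  choose F hF using hex
  let T : X →ₗ[𝕜] X :=
    { toFun := F
      map_add' := fun x y => H.injective <| by
        rw [map_add, hF, hF, hF]
        ext n
        simp [mul_add]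
      map_smul' := fun a x => H.injective <| by
        rw [map_smul, hF, hF]
        ext n
        simp only [map_smul, Pi.smul_apply, smul_eq_mul, RingHom.id_apply]
        ring }
  have hT : ∀ x n, c (T x) n = ((v n / v (n + 1) : ℝ) : 𝕜) * c x (n + 1) := fun x n =>
    congrFun (hF x) n
  have hTc : Continuous T := by
    rw [continuous_iff_continuousAt]
    intro x U hU
    obtain ⟨t, ht, ε, hε, h⟩ := (H.mem_nhds _ _).mp hU
    obtain ⟨s, hs, hst⟩ := hle t ht
    rw [mem_map, H.mem_nhds]
    refine ⟨s, hs, ε, hε, fun y hy => h _ fun n => ?_⟩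
    rw [hT, hT, ← mul_sub]
    exact (hst n _).trans (hy (n + 1))
  -- The weight at `0` never acts; truncated subtraction merely gives it a non-zero value.
  refine ⟨⟨T, hTc⟩, ⟨fun n => ((v (n - 1) / v (n - 1 + 1) : ℝ) : 𝕜), fun n => ?_, fun x n => ?_⟩, hT⟩
  · exact RCLike.ofReal_ne_zero.mpr (div_pos (hv _) (hv _)).ne'
  · exact hT x n

/-- The iterate `T^[N]` fixes `v` times any `N`-periodic sequence. Repeating a truncation of `y / v`
with a long period approximates `y`, since the copies beyond the first carry only the tail of `v`.
-/
theorem dense_periodicPts (H : IsWeightedSupSpace c α ρ) {v : ℕ → ℝ} (hv : ∀ n, 0 < v n)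
    (hv0 : ∀ t < ρ, Tendsto (fun n => v n * Real.exp (t * α n)) atTop (𝓝 0)) {T : X → X}
    (hT : ∀ x n, c (T x) n = ((v n / v (n + 1) : ℝ) : 𝕜) * c x (n + 1)) :
    Dense (Function.periodicPts T) := by
  intro y
  rw [mem_closure_iff_nhds]
  intro U hU
  obtain ⟨t, ht, ε, hε, hUsub⟩ := (H.mem_nhds _ _).mp hU
  obtain ⟨K, hK⟩ := eventually_atTop.mp
    ((H.tendsto y ht).eventually (ge_mem_nhds (half_pos hε)))
  let u : ℕ → 𝕜 := fun k => if k < K then c y k / (v k : ℝ) else 0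
  obtain ⟨F, hF0, hF⟩ : ∃ F : ℝ, 0 < F ∧ ∀ k, ‖u k‖ ≤ F := by
    refine ⟨1 + ∑ k ∈ Finset.range K, ‖u k‖, by positivity, fun k => ?_⟩
    by_cases hk : k < K
    · have := Finset.single_le_sum (f := fun k => ‖u k‖)
          (fun _ _ => norm_nonneg _) (Finset.mem_range.mpr hk)
      linarith
    · have : 0 ≤ ∑ k ∈ Finset.range K, ‖u k‖ := by positivity
      simp only [u, hk, if_false, norm_zero]
      linarith
  obtain ⟨N₀, hN₀⟩ := eventually_atTop.mp
    ((hv0 t ht).eventually (ge_mem_nhds (show (0 : ℝ) < ε / (2 * F) by positivity)))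
  set N := N₀ + K + 1 with hN
  have hnorm : ∀ k, ‖((v k : ℝ) : 𝕜) * u (k % N)‖ ≤ F * v k := by
    intro k
    rw [norm_mul, RCLike.norm_ofReal, abs_of_pos (hv k), mul_comm]
    exact mul_le_mul_of_nonneg_right (hF _) (hv k).le
  obtain ⟨x, hx⟩ : ∃ x, c x = fun k => ((v k : ℝ) : 𝕜) * u (k % N) := by
    rw [H.mem_range]
    intro s hs
    refine squeeze_zero (fun n => by positivity) (fun n => ?_)
      (by simpa using (hv0 s hs).const_mul F)
    rw [← mul_assoc]
    exact mul_le_mul_of_nonneg_right (hnorm n) (Real.exp_pos _).le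
  refine ⟨x, hUsub x fun k => ?_, N, by omega, ?_⟩
  · have hvk : ((v k : ℝ) : 𝕜) ≠ 0 := RCLike.ofReal_ne_zero.mpr (hv k).ne'
    rw [hx]
    rcases lt_or_ge k K with hk | hk
    · have : ((v k : ℝ) : 𝕜) * u (k % N) - c y k = 0 := by
        rw [Nat.mod_eq_of_lt (by omega)]
        simp only [u, hk, if_true]
        field_simp
        simp
      simp only [this, norm_zero, zero_mul]
      exact hε.le
    · have h1 : ‖((v k : ℝ) : 𝕜) * u (k % N)‖ * Real.exp (t * α k) ≤ ε / 2 := by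
        rcases lt_or_ge k N with hkN | hkN
        · rw [Nat.mod_eq_of_lt hkN]
          simp only [u, not_lt.mpr hk, if_false, mul_zero, norm_zero, zero_mul]
          positivity
        · calc _ ≤ F * v k * Real.exp (t * α k) :=
                mul_le_mul_of_nonneg_right (hnorm k) (Real.exp_pos _).le
            _ = F * (v k * Real.exp (t * α k)) := by ring
            _ ≤ F * (ε / (2 * F)) := mul_le_mul_of_nonneg_left (hN₀ k (by omega)) hF0.le
            _ = ε / 2 := by field_simp
      calc _ ≤ (‖((v k : ℝ) : 𝕜) * u (k % N)‖ + ‖c y k‖) * Real.exp (t * α k) :=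
            mul_le_mul_of_nonneg_right (norm_sub_le _ _) (Real.exp_pos _).le
        _ = _ := add_mul _ _ _
        _ ≤ ε / 2 + ε / 2 := add_le_add h1 (hK k hk)
        _ = ε := by ring
  · refine H.injective (funext fun k => ?_)
    rw [iterate_apply hv hT, hx]
    simp only [Nat.add_mod_right]
    rw [← mul_assoc, ← RCLike.ofReal_mul, div_mul_cancel₀ _ (hv _).ne']

theorem not_dense_periodicPts (H : IsWeightedSupSpace c α ρ) (hα : ∀ n, 0 < α n) {M : ℝ}
    (hM1 : 1 ≤ M) (hM : ∀ n, α (n + 1) ≤ M * α n) {v : ℕ → ℝ} (hv : ∀ n, 0 < v n)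
    {Q : ℕ → ℕ} (hQ : StrictMono Q)
    (hvQ : ∀ i n, Q i ≤ n → Real.exp (-ρ * α n + α (Q i)) ≤ v n) {T : X → X}
    (hT : ∀ x n, c (T x) n = ((v n / v (n + 1) : ℝ) : 𝕜) * c x (n + 1)) :
    ¬ Dense (Function.periodicPts T) := by
  intro hd
  have hM0 : 0 < M := by linarith
  obtain ⟨y, hy⟩ : ∃ y, c y = Pi.single 0 1 := by
    rw [H.mem_range]
    intro t _
    refine tendsto_const_nhds.congr' ?_
    filter_upwards [eventually_ge_atTop 1] with n hn
    rw [Pi.single_eq_of_ne (by omega), norm_zero, zero_mul]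
  have hU : {x | c x 0 ≠ 0} ∈ 𝓝 y := by
    rw [H.mem_nhds]
    refine ⟨ρ - 1, by linarith, Real.exp ((ρ - 1) * α 0) / 2, by positivity, fun x hx h0 => ?_⟩
    have := hx 0
    rw [h0, hy, Pi.single_eq_same, zero_sub, norm_neg, norm_one, one_mul] at this
    linarith [Real.exp_pos ((ρ - 1) * α 0)]
  obtain ⟨x, hx0, N, hN, hper⟩ := mem_closure_iff_nhds.mp (hd y) _ hU
  have hx : ∀ l, ‖c x (l * N)‖ = v (l * N) * (‖c x 0‖ / v 0) := by
    intro l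
    have h1 : T^[l * N] x = x := by
      exact (hper.const_mul l).eq
    have h2 := iterate_apply hv hT (l * N) x 0
    rw [h1, zero_add] at h2
    rw [h2, norm_mul, RCLike.norm_ofReal, abs_of_pos (div_pos (hv _) (hv _))]
    have := hv 0
    have := hv (l * N)
    field_simp
  have hpow : ∀ d n, α (n + d) ≤ M ^ d * α n := by
    intro d n
    induction d with
    | zero => simp
    | succ d ih =>
      calc α (n + d + 1) ≤ M * α (n + d) := hM _
        _ ≤ M * (M ^ d * α n) := mul_le_mul_of_nonneg_left ih hM0.le
        _ = M ^ (d + 1) * α n := by ring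
  -- Within `N` steps `α` grows by a factor of at most `M ^ N`, so the loss `(M ^ N)⁻¹ * α n` in the
  -- exponent is at most the surplus `α (Q i)` carried by `v`.
  have ht : ρ - (M ^ N)⁻¹ < ρ := sub_lt_self _ (by positivity)
  have hpos : 0 < ‖c x 0‖ / v 0 := div_pos (norm_pos_iff.mpr hx0) (hv 0)
  obtain ⟨n₀, hn₀⟩ := eventually_atTop.mp ((H.tendsto x ht).eventually (gt_mem_nhds hpos))
  -- `l * N` is the first multiple of `N` after `Q n₀`, hence at most `Q n₀ + N`.
  set l := Q n₀ / N + 1 with hl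
  have hdm := Nat.div_add_mod (Q n₀) N
  have hlt := Nat.mod_lt (Q n₀) hN
  have hlN : l * N = N * (Q n₀ / N) + N := by rw [hl]; ring
  have hQn := hQ.id_le n₀
  simp only [id] at hQn
  have h1 := hn₀ (l * N) (by omega)
  rw [hx] at h1
  obtain ⟨d, hd⟩ := Nat.exists_eq_add_of_le (show Q n₀ ≤ l * N by omega)
  have hαle : α (l * N) ≤ M ^ N * α (Q n₀) := by
    rw [hd]
    refine (hpow d _).trans (mul_le_mul_of_nonneg_right ?_ (hα _).le)
    exact pow_le_pow_right₀ hM1 (by omega)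
  have h2 : 1 ≤ v (l * N) * Real.exp ((ρ - (M ^ N)⁻¹) * α (l * N)) := by
    refine le_trans ?_ (mul_le_mul_of_nonneg_right (hvQ n₀ (l * N) (by omega)) (Real.exp_pos _).le)
    rw [← Real.exp_add]
    refine Real.one_le_exp ?_
    have h3 := mul_le_mul_of_nonneg_left hαle (show 0 ≤ (M ^ N)⁻¹ by positivity)
    rw [inv_mul_cancel_left₀ (by positivity)] at h3
    linarith
  have h3 := mul_le_mul_of_nonneg_right h2 hpos.le
  rw [one_mul] at h3
  refine absurd h1 (not_lt.mpr (h3.trans (le_of_eq ?_)))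
  ring

/-- The vector is `v * z`, where `z` carries a copy of block `p` at each position in `A p`. Shifting
by `m ∈ A q` puts block `q` at the origin; any other block `p` appears at a difference of positions,
where `hbound` applies with `s = max p q` and also absorbs the size of the block. -/
theorem isFrequentlyHypercyclic (H : IsWeightedSupSpace c α ρ) (hα : ∀ n, 0 < α n)
    {κ Q g : ℕ → ℕ} (R : RapidGrowth κ Q g) (hQ : StrictMono Q) (hκ : ∀ s, s ≤ κ s)
    {v : ℕ → ℝ} (hv : ∀ n, 0 < v n)
    (hbound : ∀ s : ℕ, 1 ≤ s → ∀ k, FarBeyond Q (κ s) k →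
      (s : ℝ) ^ 2 * (v k * Real.exp ((ρ - 1 / s) * α k)) ≤ 1) {T : X → X}
    (hT : ∀ x n, c (T x) n = ((v n / v (n + 1) : ℝ) : 𝕜) * c x (n + 1)) :
    IsFrequentlyHypercyclic T := by
  obtain ⟨f, hf0, hfle, hfd⟩ := exists_dense_blocks 𝕜
  set A := sparseMultiples Q g with hA
  -- Blocks do not overlap: distinct positions differ by at least `κ (max p q) ≥ max p q`, which
  -- exceeds the offset within either block.
  have hsep : ∀ p q n m h h', n ∈ A p → m ∈ A q → h < p → h' < q → n + h = m + h' → m ≤ n := by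
    intro p q n m h h' hn hm hh hh' he
    by_contra hlt
    have := (R.farBeyond_sub hm hn (not_le.mp hlt) (Nat.zero_le _)).1
    have := hκ (max q p)
    omega
  obtain ⟨z, hz, hz'⟩ := exists_block_sequence A f (by
    intro p q n m h h' hn hm hh hh' he
    have hnm : n = m := le_antisymm (hsep q p m n h' h hm hn hh' hh he.symm)
      (hsep p q n m h h' hn hm hh hh' he)
    subst hnm
    exact ⟨rfl, R.index_unique hn hm⟩)
  have hsmall : ∀ (s p k h : ℕ), 1 ≤ s → p ≤ s → FarBeyond Q (κ s) k → ∀ t ≤ ρ - 1 / s,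
      ‖((v k : ℝ) : 𝕜) * f p h‖ * Real.exp (t * α k) ≤ 1 / s := by
    intro s p k h hs hps hk t ht
    have hs0 : (0 : ℝ) < s := by exact_mod_cast hs
    have h1 : Real.exp (t * α k) ≤ Real.exp ((ρ - 1 / s) * α k) :=
      Real.exp_le_exp.mpr (mul_le_mul_of_nonneg_right ht (hα k).le)
    have h2 : ‖f p h‖ ≤ s := (hfle p h).trans (by exact_mod_cast hps)
    rw [norm_mul, RCLike.norm_ofReal, abs_of_pos (hv k), le_div_iff₀ hs0]
    have := hv k
    calc v k * ‖f p h‖ * Real.exp (t * α k) * s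
        ≤ v k * s * Real.exp ((ρ - 1 / s) * α k) * s := by gcongr
      _ = (s : ℝ) ^ 2 * (v k * Real.exp ((ρ - 1 / s) * α k)) := by ring
      _ ≤ 1 := hbound s hs k hk
  have hlarge : ∀ t < ρ, ∀ ε > 0, ∃ s₀ : ℕ, 1 ≤ s₀ ∧ ∀ s ≥ s₀, t ≤ ρ - 1 / s ∧ 1 / (s : ℝ) ≤ ε := by
    intro t ht ε hε
    have h0 : 0 < min (ρ - t) ε := lt_min (by linarith) hε
    obtain ⟨s₀, hs₀⟩ := exists_nat_one_div_lt h0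
    refine ⟨s₀ + 1, by omega, fun s hs => ?_⟩
    have h1 : 1 / (s : ℝ) ≤ 1 / ((s₀ : ℝ) + 1) :=
      one_div_le_one_div_of_le (by positivity) (by exact_mod_cast hs)
    have h2 := min_le_left (ρ - t) ε
    have h3 := min_le_right (ρ - t) ε
    exact ⟨by linarith, by linarith⟩
  obtain ⟨x, hx⟩ : ∃ x, c x = fun k => ((v k : ℝ) : 𝕜) * z k := by
    rw [H.mem_range]
    intro t ht
    rw [Metric.tendsto_atTop]
    intro ε hε
    obtain ⟨s, hs1, hs⟩ := hlarge t ht (ε / 2) (half_pos hε)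
    -- For `p < s` the offset is below `s`, which leaves `n ≥ 2 * Q s`; for `p ≥ s` this follows
    -- from `2 * Q p ∣ n`.
    refine ⟨2 * Q s + s, fun k hk => ?_⟩
    rw [Real.dist_0_eq_abs, abs_of_nonneg (by positivity)]
    rcases hz' k with h0 | ⟨p, n, h, hn, hh, rfl, hzk⟩
    · simpa [h0] using hε
    · have hn2 : 2 * Q s ≤ n := by
        rcases lt_or_ge p s with hps | hps
        · omega
        · have h1 := Nat.le_of_dvd hn.1 hn.2.1
          have h2 := hQ.monotone hps
          omega
      have hmax := hs (max p s) (le_max_right _ _)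
      rw [hzk]
      refine lt_of_le_of_lt ((hsmall (max p s) p (n + h) h (by omega) (le_max_left _ _)
        (R.farBeyond_add hn hn2 hh.le) t hmax.1).trans hmax.2) (half_lt_self hε)
  refine ⟨x, fun U hUo hUne => ?_⟩
  obtain ⟨y, hy⟩ := hUne
  obtain ⟨t, ht, ε, hε, hUsub⟩ := (H.mem_nhds _ _).mp (hUo.mem_nhds hy)
  obtain ⟨K, hK⟩ := eventually_atTop.mp
    ((H.tendsto y ht).eventually (ge_mem_nhds (half_pos hε)))
  obtain ⟨s₀, hs1, hs⟩ := hlarge t ht (ε / 2) (half_pos hε)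
  obtain ⟨B, hB0, hB⟩ : ∃ B : ℝ, 0 < B ∧ ∀ k < K, v k * Real.exp (t * α k) ≤ B := by
    have hnn : ∀ k, 0 ≤ v k * Real.exp (t * α k) := fun k => mul_nonneg (hv k).le (Real.exp_pos _).le
    refine ⟨1 + ∑ k ∈ Finset.range K, v k * Real.exp (t * α k),
      add_pos_of_pos_of_nonneg one_pos (Finset.sum_nonneg fun k _ => hnn k), fun k hk => ?_⟩
    have := Finset.single_le_sum (f := fun k => v k * Real.exp (t * α k))
          (fun k _ => hnn k) (Finset.mem_range.mpr hk)
    linarith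
  -- `q ≥ K` lets the block cover all coordinates to be matched, and `q ≥ s₀` makes every
  -- interfering block small, whatever its index.
  obtain ⟨q, hq, hq1, hq2⟩ := hfd (fun k => c y k / (v k : ℝ)) K (ε / B) (by positivity) (s₀ + K)
  refine lowerDensity_pos_mono (A := A q) (fun m hm => hUsub _ fun k => ?_) (R.lowerDensity_pos hQ q)
  have hvk : ((v k : ℝ) : 𝕜) ≠ 0 := RCLike.ofReal_ne_zero.mpr (hv k).ne'
  have hck : c (T^[m] x) k = ((v k : ℝ) : 𝕜) * z (k + m) := by
    rw [iterate_apply hv hT, hx]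
    simp only
    rw [← mul_assoc, ← RCLike.ofReal_mul, div_mul_cancel₀ _ (hv _).ne']
  rw [hck]
  rcases lt_or_ge k K with hk | hk
  · rw [add_comm k m, hz q m k hm (by omega)]
    have h1 : ((v k : ℝ) : 𝕜) * f q k - c y k = ((v k : ℝ) : 𝕜) * (f q k - c y k / (v k : ℝ)) := by
      field_simp
    rw [h1, norm_mul, RCLike.norm_ofReal, abs_of_pos (hv k)]
    calc v k * ‖f q k - c y k / (v k : ℝ)‖ * Real.exp (t * α k)
        = v k * Real.exp (t * α k) * ‖f q k - c y k / (v k : ℝ)‖ := by ring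
      _ ≤ B * (ε / B) := mul_le_mul (hB k hk) (hq1 k hk).le (norm_nonneg _) hB0.le
      _ = ε := by field_simp
  · have h1 : ‖((v k : ℝ) : 𝕜) * z (k + m)‖ * Real.exp (t * α k) ≤ ε / 2 := by
      rcases lt_or_ge k q with hkq | hkq
      · rw [add_comm k m, hz q m k hm hkq, hq2 k hk]
        simp only [mul_zero, norm_zero, zero_mul]
        positivity
      · rcases hz' (k + m) with h0 | ⟨p, n, h, hn, hh, hkm, hzk⟩
        · rw [h0]
          simp only [mul_zero, norm_zero, zero_mul]
          positivity
        · have hmn : m < n := by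
            rcases lt_trichotomy m n with h1 | rfl | h1
            · exact h1
            · have := R.index_unique hn hm
              omega
            · have h2 := (R.farBeyond_sub hm hn h1 (Nat.zero_le _)).1
              have h3 := hκ (max q p)
              omega
          have hk' : k = n - m + h := by omega
          have hmax := hs (max p q) (le_trans (by omega) (le_max_right p q))
          rw [hzk]
          refine (hsmall (max p q) p k h (by omega) (le_max_left _ _) ?_ t hmax.1).trans hmax.2
          rw [hk']
          exact R.farBeyond_sub hn hm hmn hh.le
    calc _ ≤ (‖((v k : ℝ) : 𝕜) * z (k + m)‖ + ‖c y k‖) * Real.exp (t * α k) :=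
          mul_le_mul_of_nonneg_right (norm_sub_le _ _) (Real.exp_pos _).le
      _ = _ := add_mul _ _ _
      _ ≤ ε / 2 + ε / 2 := add_le_add h1 (hK k hk)
      _ = ε := by ring

end IsWeightedSupSpace

/-! ### Choice of the weights. -/

/-- Fast growth gives `α (k - κ) ≤ α k / (2 * s)`, so half of `α k / s` remains in the exponent; for
large `k` it is at least `s ^ 2`, and `exp (-s ^ 2)` absorbs the factor `s ^ 2`. -/
theorem exists_delay {α : ℕ → ℝ} (hα_pos : ∀ n, 0 < α n) (hα_mono : Monotone α)
    (hα_lim : Tendsto α atTop atTop) (hα_fast : ∀ K : ℝ, ∃ j, ∀ᶠ n in atTop, K * α n ≤ α (n + j))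
    (s : ℕ) : ∃ κ, s ≤ κ ∧ (1 ≤ s → ∀ k, κ ≤ k →
      (s : ℝ) ^ 2 * Real.exp (α (k - κ) - α k / s) ≤ 1) := by
  obtain ⟨j, hj⟩ := hα_fast (2 * s)
  obtain ⟨n₀, hn₀⟩ := eventually_atTop.mp hj
  obtain ⟨k₀, hk₀⟩ := eventually_atTop.mp
    (hα_lim.eventually_ge_atTop (2 * s * (α n₀ + (s : ℝ) ^ 2)))
  refine ⟨s + j + k₀, by omega, fun hs k hk => ?_⟩
  have hs0 : (0 : ℝ) < s := by exact_mod_cast hs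
  have hn₀pos := hα_pos n₀
  have h1 := hk₀ k (by omega)
  have hdiff : α (k - (s + j + k₀)) ≤ α k / (2 * s) := by
    rw [le_div_iff₀ (by positivity), mul_comm]
    rcases le_total n₀ (k - (s + j + k₀)) with h | h
    · exact (hn₀ _ h).trans (hα_mono (by omega))
    · refine (mul_le_mul_of_nonneg_left (hα_mono h) (by positivity)).trans (le_trans ?_ h1)
      exact mul_le_mul_of_nonneg_left (by nlinarith) (by positivity)
  have h2 : (s : ℝ) ^ 2 ≤ α k / (2 * s) := by
    rw [le_div_iff₀ (by positivity), mul_comm]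
    exact (mul_le_mul_of_nonneg_left (by linarith) (by positivity)).trans h1
  have h3 : α k / s = α k / (2 * s) + α k / (2 * s) := by
    field_simp
    ring
  calc (s : ℝ) ^ 2 * Real.exp (α (k - (s + j + k₀)) - α k / s)
      ≤ Real.exp ((s : ℝ) ^ 2) * Real.exp (-(s : ℝ) ^ 2) := by
        refine mul_le_mul ?_ (Real.exp_le_exp.mpr (by linarith)) (Real.exp_pos _).le
          (Real.exp_pos _).le
        linarith [Real.add_one_le_exp ((s : ℝ) ^ 2)]
    _ = 1 := by rw [← Real.exp_add, add_neg_cancel, Real.exp_zero]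

theorem IsWeightedSupSpace.exists_weightedShifts {𝕜 X : Type*} [RCLike 𝕜] [AddCommGroup X]
    [Module 𝕜 X] [TopologicalSpace X] {c : X →ₗ[𝕜] (ℕ → 𝕜)} {α : ℕ → ℝ} {ρ : ℝ}
    (H : IsWeightedSupSpace c α ρ) (hα_pos : ∀ n, 0 < α n) (hα_mono : Monotone α)
    (hα_lim : Tendsto α atTop atTop) (hα_slow : ∃ M, 1 ≤ M ∧ ∀ n, α (n + 1) ≤ M * α n)
    (hα_fast : ∀ K : ℝ, ∃ j, ∀ᶠ n in atTop, K * α n ≤ α (n + j)) :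
    (∃ T : X →L[𝕜] X, IsWeightedShift c T ∧ IsChaotic T) ∧
      ∃ T : X →L[𝕜] X, IsWeightedShift c T ∧ IsFrequentlyHypercyclic T ∧ ¬ IsChaotic T := by
  classical
  obtain ⟨M, hM1, hM⟩ := hα_slow
  have hM0 : 0 < M := by linarith
  choose κ hκ hκb using exists_delay hα_pos hα_mono hα_lim hα_fast
  obtain ⟨Q, g, hQ, R⟩ := exists_rapidGrowth κ
  have hshift : ∀ b : ℕ → ℝ, Monotone b → ∃ T : X →L[𝕜] X, IsWeightedShift c T ∧
      ∀ x n, c (T x) n = ((Real.exp (-ρ * α n + b n) /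
        Real.exp (-ρ * α (n + 1) + b (n + 1)) : ℝ) : 𝕜) * c x (n + 1) := by
    intro b hb
    refine H.exists_shift (v := fun n => Real.exp (-ρ * α n + b n)) (fun n => Real.exp_pos _)
      -- After cancelling `ρ`, continuity asks for `(ρ - s) * α (n + 1) ≤ (ρ - t) * α n`, which
      -- dividing the margin by `M` achieves.
      fun t ht => ⟨ρ - (ρ - t) / M, sub_lt_self _ (div_pos (by linarith) hM0), fun n => ?_⟩
    rw [← Real.exp_sub, ← Real.exp_add, Real.exp_le_exp]
    have h1 := hb (Nat.le_succ n)
    have h2 : (ρ - t) / M * α (n + 1) ≤ (ρ - t) * α n := by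
      rw [div_mul_eq_mul_div, div_le_iff₀ hM0]
      linarith [mul_le_mul_of_nonneg_left (hM n) (sub_nonneg.mpr ht.le)]
    simp only [Nat.succ_eq_add_one] at h1
    linarith
  have hfhc : ∀ b : ℕ → ℝ, (∀ s k, FarBeyond Q (κ s) k → b k ≤ α (k - κ s)) → ∀ T : X →L[𝕜] X,
      (∀ x n, c (T x) n = ((Real.exp (-ρ * α n + b n) /
        Real.exp (-ρ * α (n + 1) + b (n + 1)) : ℝ) : 𝕜) * c x (n + 1)) →
      IsFrequentlyHypercyclic T := by
    intro b hb T hT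
    refine H.isFrequentlyHypercyclic (v := fun n => Real.exp (-ρ * α n + b n)) hα_pos R hQ hκ
      (fun n => Real.exp_pos _) (fun s hs k hk => le_trans ?_ (hκb s hs k hk.1)) hT
    rw [← Real.exp_add]
    refine mul_le_mul_of_nonneg_left (Real.exp_le_exp.mpr ?_) (by positivity)
    have h1 := hb s k hk
    have h2 : (ρ - 1 / s) * α k = ρ * α k - α k / s := by ring
    linarith
  constructor
  · obtain ⟨T, hTs, hT⟩ := hshift (fun _ => 0) monotone_const
    refine ⟨T, hTs, (hfhc _ (fun s k _ => (hα_pos _).le) T hT).isHypercyclic, ?_⟩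
    refine H.dense_periodicPts (v := fun n => Real.exp (-ρ * α n + 0)) (fun n => Real.exp_pos _)
      (fun t ht => ?_) hT
    have h1 : Tendsto (fun n => (ρ - t) * α n) atTop atTop :=
      hα_lim.const_mul_atTop (by linarith)
    refine (Real.tendsto_exp_neg_atTop_nhds_zero.comp h1).congr fun n => ?_
    simp only [Function.comp]
    rw [← Real.exp_add]
    congr 1
    ring
  · set N : ℕ → ℕ := fun n => Nat.findGreatest (· ∈ Set.range Q) n with hN
    have hNmono : Monotone N := fun m n hmn => Nat.findGreatest_mono_right _ hmn
    obtain ⟨T, hTs, hT⟩ := hshift (fun n => α (N n)) (hα_mono.comp hNmono)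
    refine ⟨T, hTs, hfhc _ (fun s k hk => hα_mono ?_) T hT, fun hch => ?_⟩
    · have h1 : N k + κ s ≤ k := by
        -- `Nat.findGreatest` returns `0` when no `Q i` is at most `k`; the clause `K ≤ k` of
        -- `FarBeyond` covers this default.
        by_cases h0 : N k = 0
        · rw [h0, zero_add]
          exact hk.1
        · obtain ⟨i, hi⟩ := Nat.findGreatest_of_ne_zero rfl h0
          have hle : N k ≤ k := Nat.findGreatest_le k
          simp only [hN] at hle ⊢
          rw [← hi] at hle ⊢
          exact hk.2 i hle
      omega
    · refine H.not_dense_periodicPts hα_pos hM1 hM (v := fun n => Real.exp (-ρ * α n + α (N n)))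
        (fun n => Real.exp_pos _) hQ (fun i n hin => ?_) hT hch.2
      have := hα_mono (Nat.le_findGreatest hin ⟨i, rfl⟩ : Q i ≤ N n)
      exact Real.exp_le_exp.mpr (by linarith)

/-! ### Power series spaces as weighted sup-spaces. -/

theorem WithSeminorms.mem_nhds_iff_of_monotone {𝕜 E : Type*} [RCLike 𝕜] [AddCommGroup E]
    [Module 𝕜 E] [TopologicalSpace E] {r : ℝ} {P : SeminormFamily 𝕜 E (Set.Iio r)}
    (hP : WithSeminorms P) (hmono : Monotone P) (x : E) (U : Set E) :
    U ∈ 𝓝 x ↔ ∃ t : Set.Iio r, ∃ ε > 0, ∀ y, P t (y - x) < ε → y ∈ U := by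
  rw [hP.mem_nhds_iff]
  constructor
  · rintro ⟨s, ε, hε, hs⟩
    have : Nonempty (Set.Iio r) := ⟨⟨r - 1, by simp⟩⟩
    obtain ⟨t, ht⟩ := s.exists_le
    refine ⟨t, ε, hε, fun y hy => hs ?_⟩
    rw [Seminorm.mem_ball]
    exact lt_of_le_of_lt (Finset.sup_le (fun i hi => hmono (ht i hi)) (y - x)) hy
  · rintro ⟨t, ε, hε, h⟩
    refine ⟨{t}, ε, hε, fun y hy => h y ?_⟩
    rwa [Finset.sup_singleton, Seminorm.mem_ball] at hy

theorem PowerSeriesSpaceZero.isWeightedSupSpace {𝕜 : Type*} [RCLike 𝕜] {α : ℕ → ℝ}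
    (hα : ∀ n, 0 < α n) (r : ℝ) : IsWeightedSupSpace (coord 𝕜 r α) α r := by
  have happ : ∀ (t : Set.Iio r) (x : PowerSeriesSpaceZero 𝕜 r α), seminorms 𝕜 r α t x =
      ⨆ n, ‖coord 𝕜 r α x n‖ * Real.exp ((t : ℝ) * α n) := fun _ _ => rfl
  have hbdd : ∀ (t : Set.Iio r) (x : PowerSeriesSpaceZero 𝕜 r α),
      BddAbove (Set.range fun n => ‖coord 𝕜 r α x n‖ * Real.exp ((t : ℝ) * α n)) :=
    fun t x => (coord_mem x t t.2).bddAbove_range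
  have hmono : Monotone (seminorms 𝕜 r α) := by
    intro t t' htt' x
    change seminorms 𝕜 r α t x ≤ seminorms 𝕜 r α t' x
    rw [happ, happ]
    refine ciSup_mono (hbdd t' x) fun n => ?_
    have := (hα n).le
    have : (t : ℝ) ≤ t' := htt'
    gcongr
  refine ⟨Subtype.val_injective, fun x => ⟨?_, fun h => ⟨⟨x, h⟩, rfl⟩⟩, fun x U => ?_⟩
  · rintro ⟨y, rfl⟩ t ht
    exact coord_mem y t ht
  · rw [withSeminorms.mem_nhds_iff_of_monotone hmono]
    constructor
    · rintro ⟨t, ε, hε, h⟩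
      refine ⟨t, t.2, ε / 2, half_pos hε, fun y hy => h y ?_⟩
      rw [happ]
      refine lt_of_le_of_lt (ciSup_le fun n => ?_) (half_lt_self hε)
      rw [map_sub, Pi.sub_apply]
      exact hy n
    · rintro ⟨t, ht, ε, hε, h⟩
      refine ⟨⟨t, ht⟩, ε, hε, fun y hy => h y fun n => ?_⟩
      rw [happ] at hy
      have := le_ciSup (hbdd ⟨t, ht⟩ (y - x)) n
      rw [map_sub, Pi.sub_apply] at this
      exact this.trans (by simpa only [map_sub, Pi.sub_apply] using hy.le)

theorem Real.mul_exp_rpow {u : ℝ} (hu : 0 ≤ u) (a p : ℝ) :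
    (u * Real.exp a) ^ p = u ^ p * Real.exp (a * p) := by
  rw [Real.mul_rpow hu (Real.exp_pos _).le, ← Real.exp_mul]

/-- A sup-bound at a slightly larger exponent `t'` yields an `ℓ^p`-bound at `t`, because `exp (-(t'
- t) * α n)` is summable; the converse holds term by term. Taking `p`-th roots divides exponents by
`p`. -/
theorem PowerSeriesSpace.isWeightedSupSpace {𝕜 : Type*} [RCLike 𝕜] {p : ℝ} (hp : 1 ≤ p)
    {α : ℕ → ℝ} (hα : ∀ n, 0 < α n) (hsum : ∀ s > 0, Summable fun n => Real.exp (-s * α n))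
    (r : ℝ) : IsWeightedSupSpace (coord 𝕜 p hp r α) α (r / p) := by
  have hp0 : 0 < p := by linarith
  have happ : ∀ (t : Set.Iio r) (x : PowerSeriesSpace 𝕜 p hp r α), seminorms 𝕜 p hp r α t x =
      (∑' n, ‖coord 𝕜 p hp r α x n‖ ^ p * Real.exp ((t : ℝ) * α n)) ^ (1 / p) := fun _ _ => rfl
  have hmono : Monotone (seminorms 𝕜 p hp r α) := by
    intro t t' htt' x
    change seminorms 𝕜 p hp r α t x ≤ seminorms 𝕜 p hp r α t' x
    rw [happ, happ]
    refine Real.rpow_le_rpow (tsum_nonneg fun n => by positivity)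
      ((coord_mem x t t.2).tsum_le_tsum (fun n => ?_) (coord_mem x t' t'.2)) (by positivity)
    have := (hα n).le
    have : (t : ℝ) ≤ t' := htt'
    gcongr
  have hterm : ∀ (u : ℝ), 0 ≤ u → ∀ (t : ℝ) n,
      (u * Real.exp (t * α n)) ^ p = u ^ p * Real.exp (t * p * α n) := by
    intro u hu t n
    rw [Real.mul_exp_rpow hu]
    congr 2
    ring
  have hcmp : ∀ (u C : ℝ), 0 ≤ u → ∀ (t t' : ℝ) n, u * Real.exp (t' / p * α n) ≤ C →
      u ^ p * Real.exp (t * α n) ≤ C ^ p * Real.exp (-(t' - t) * α n) := by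
    intro u C hu t t' n h
    have h1 := Real.rpow_le_rpow (by positivity) h hp0.le
    rw [hterm u hu, div_mul_cancel₀ _ hp0.ne'] at h1
    calc u ^ p * Real.exp (t * α n)
        = u ^ p * Real.exp (t' * α n) * Real.exp (-(t' - t) * α n) := by
          rw [mul_assoc, ← Real.exp_add]
          congr 2
          ring
      _ ≤ _ := mul_le_mul_of_nonneg_right h1 (Real.exp_pos _).le
  refine ⟨Subtype.val_injective, fun x => ⟨?_, fun h => ⟨⟨x, fun t ht => ?_⟩, rfl⟩⟩, fun x U => ?_⟩
  · rintro ⟨y, rfl⟩ t ht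
    have h1 := (coord_mem y (t * p) ((lt_div_iff₀ hp0).mp ht)).tendsto_atTop_zero
    have h2 := h1.rpow_const (p := 1 / p) (Or.inr (by positivity))
    rw [Real.zero_rpow (by positivity)] at h2
    refine h2.congr fun n => ?_
    rw [← hterm _ (norm_nonneg _), ← Real.rpow_mul (by positivity), mul_one_div_cancel hp0.ne',
      Real.rpow_one]
  · obtain ⟨t', htt', ht'⟩ := exists_between ht
    obtain ⟨C, hC⟩ := (h (t' / p) (div_lt_div_of_pos_right ht' hp0)).bddAbove_range
    refine Summable.of_nonneg_of_le (fun n => by positivity)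
      (fun n => hcmp _ C (norm_nonneg _) t t' n (hC ⟨n, rfl⟩))
      ((hsum (t' - t) (by linarith)).mul_left _)
  · rw [withSeminorms.mem_nhds_iff_of_monotone hmono]
    constructor
    · rintro ⟨⟨t, ht⟩, ε, hε, h⟩
      obtain ⟨t', htt', ht'⟩ := exists_between (show t < r from ht)
      set S := ∑' n, Real.exp (-(t' - t) * α n) with hS
      have hS0 : 0 ≤ S := tsum_nonneg fun n => (Real.exp_pos _).le
      have hSp : 0 ≤ S ^ (1 / p) := Real.rpow_nonneg hS0 _
      set η := ε / (S ^ (1 / p) + 1) with hη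
      have hη0 : 0 < η := by positivity
      refine ⟨t' / p, div_lt_div_of_pos_right ht' hp0, η, hη0, fun y hy => h y ?_⟩
      rw [happ]
      have hsum' := (hsum (t' - t) (by linarith)).mul_left (η ^ p)
      have h1 : ∑' n, ‖coord 𝕜 p hp r α (y - x) n‖ ^ p * Real.exp (t * α n) ≤ η ^ p * S := by
        rw [hS, ← tsum_mul_left]
        refine (coord_mem (y - x) t ht).tsum_le_tsum (fun n => ?_) hsum'
        refine hcmp _ η (norm_nonneg _) t t' n ?_
        rw [map_sub, Pi.sub_apply]
        exact hy n
      refine lt_of_le_of_lt (Real.rpow_le_rpow (tsum_nonneg fun n => by positivity) h1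
        (by positivity)) ?_
      rw [Real.mul_rpow (by positivity) hS0, ← Real.rpow_mul hη0.le, mul_one_div_cancel hp0.ne',
        Real.rpow_one, hη, div_mul_eq_mul_div, div_lt_iff₀ (by positivity)]
      linarith
    · rintro ⟨t, ht, ε, hε, h⟩
      have ht' : t * p < r := (lt_div_iff₀ hp0).mp ht
      refine ⟨⟨t * p, ht'⟩, ε, hε, fun y hy => h y fun n => le_trans ?_ hy.le⟩
      rw [happ, ← Pi.sub_apply, ← map_sub]
      have h1 := (coord_mem (y - x) (t * p) ht').le_tsum n fun i _ => by positivity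
      have h2 := Real.rpow_le_rpow (by positivity) h1 (show 0 ≤ 1 / p by positivity)
      rwa [← hterm _ (norm_nonneg _), ← Real.rpow_mul (by positivity), mul_one_div_cancel hp0.ne',
        Real.rpow_one] at h2

/-! ### Consequences of the growth hypotheses. -/

section Growth

variable {α : ℕ → ℝ}

theorem exists_forall_succ_le_mul (hα_pos : ∀ n, 0 < α n)
    (h : limsup (fun n => ((α (n + 1) / α n : ℝ) : EReal)) atTop < ⊤) :
    ∃ M, 1 ≤ M ∧ ∀ n, α (n + 1) ≤ M * α n := by
  obtain ⟨b, hb, -⟩ := EReal.lt_iff_exists_real_btwn.mp h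
  have hev := eventually_lt_of_limsup_lt hb
  have hbdd : BddAbove (Set.range fun n => α (n + 1) / α n) := by
    refine IsBoundedUnder.bddAbove_range ⟨b, eventually_map.mpr ?_⟩
    filter_upwards [hev] with n hn
    exact (EReal.coe_lt_coe_iff.mp hn).le
  obtain ⟨M, hM⟩ := hbdd
  refine ⟨max 1 M, le_max_left _ _, fun n => ?_⟩
  rw [← div_le_iff₀ (hα_pos n)]
  exact (hM ⟨n, rfl⟩).trans (le_max_right _ _)

theorem exists_eventually_mul_le_of_limsup_eq_top (hα_pos : ∀ n, 0 < α n)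
    (h : limsup (fun j : ℕ => liminf (fun n => ((α (n + j) / α n : ℝ) : EReal)) atTop) atTop = ⊤)
    (K : ℝ) : ∃ j, ∀ᶠ n in atTop, K * α n ≤ α (n + j) := by
  have hK : (K : EReal) < limsup (fun j : ℕ =>
      liminf (fun n => ((α (n + j) / α n : ℝ) : EReal)) atTop) atTop := by
    rw [h]
    exact EReal.coe_lt_top K
  obtain ⟨j, hj⟩ := (frequently_lt_of_lt_limsup (by isBoundedDefault) hK).exists
  refine ⟨j, ?_⟩
  filter_upwards [eventually_lt_of_lt_liminf hj] with n hn
  rw [← le_div_iff₀ (hα_pos n)]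
  exact (EReal.coe_lt_coe_iff.mp hn).le

theorem summable_Ici_iff {f : ℕ → ℝ} {j : ℕ} :
    (Summable fun n : Set.Ici j => f n) ↔ Summable f := by
  rw [← Finset.summable_compl_iff (Finset.range j)]
  have hset : {n | n ∉ Finset.range j} = Set.Ici j := by
    ext n
    simp
  exact (Equiv.setCongr hset).summable_iff.symm

variable {ε : ℝ}

/-- The summands tend to `0` and `ε < 1`, so the exponents are eventually positive; with `δ = 1 /
max K 1` this is the required inequality. -/
theorem exists_eventually_mul_le_of_summable (hα_pos : ∀ n, 0 < α n) (hε0 : 0 < ε) (hε1 : ε < 1)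
    (h : ∀ δ : ℝ, 0 < δ → ∃ j : ℕ, 1 ≤ j ∧
      Summable fun n : Set.Ici j => ε ^ (-α ((n : ℕ) - j) + δ * α (n : ℕ)))
    (K : ℝ) : ∃ j, ∀ᶠ n in atTop, K * α n ≤ α (n + j) := by
  have hK : 0 < max K 1 := lt_max_of_lt_right one_pos
  obtain ⟨j, -, hj⟩ := h (1 / max K 1) (by positivity)
  have h1 := (summable_Ici_iff (f := fun n => ε ^ (-α (n - j) + 1 / max K 1 * α n))).mp hj
  have h2 := h1.tendsto_atTop_zero.comp (tendsto_add_atTop_nat j)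
  refine ⟨j, ?_⟩
  filter_upwards [h2.eventually (gt_mem_nhds one_pos)] with n hn
  simp only [Function.comp, Nat.add_sub_cancel] at hn
  have h3 : 0 < -α n + 1 / max K 1 * α (n + j) := by
    by_contra hle
    exact absurd hn (not_lt.mpr (Real.one_le_rpow_of_pos_of_le_one_of_nonpos hε0 hε1.le
      (not_lt.mp hle)))
  have h4 : max K 1 * α n ≤ α (n + j) := by
    rw [one_div_mul_eq_div] at h3
    have h5 : α n ≤ α (n + j) / max K 1 := by linarith
    rw [le_div_iff₀ hK] at h5
    linarith
  exact (mul_le_mul_of_nonneg_right (le_max_left K 1) (hα_pos n).le).trans h4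

theorem summable_exp_neg_mul (hα_pos : ∀ n, 0 < α n) (hε0 : 0 < ε) (hε1 : ε < 1)
    (h : ∀ δ : ℝ, 0 < δ → ∃ j : ℕ, 1 ≤ j ∧
      Summable fun n : Set.Ici j => ε ^ (-α ((n : ℕ) - j) + δ * α (n : ℕ)))
    (s : ℝ) (hs : 0 < s) : Summable fun n => Real.exp (-s * α n) := by
  have hlog := Real.log_neg hε0 hε1
  -- This `δ` gives `ε ^ (δ * α n) = exp (-s * α n)`, and the remaining factor `ε ^ (-α (n - j))` is
  -- at least `1`.
  obtain ⟨j, -, hj⟩ := h (s / -Real.log ε) (div_pos hs (by linarith))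
  refine Summable.of_nonneg_of_le (fun n => (Real.exp_pos _).le) (fun n => ?_)
    ((summable_Ici_iff (f := fun n => ε ^ (-α (n - j) + s / -Real.log ε * α n))).mp hj)
  rw [Real.rpow_def_of_pos hε0, Real.exp_le_exp]
  have h1 : Real.log ε * (-α (n - j) + s / -Real.log ε * α n) =
      -Real.log ε * α (n - j) - s * α n := by
    have := hlog.ne
    field_simp
    ring
  rw [h1]
  have := mul_pos (neg_pos.mpr hlog) (hα_pos (n - j))
  linarith

end Growth

theorem theorem4p9 {𝕜 : Type*} [RCLike 𝕜] (α : ℕ → ℝ) (hα_pos : ∀ n, 0 < α n)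
    (hα_mono : Monotone α) (hα_lim : Tendsto α atTop atTop) (r : ℝ)
    (hα_quot : limsup (fun n => ((α (n + 1) / α n : ℝ) : EReal)) atTop < ⊤) :
    (∀ (p : ℝ) (hp : 1 ≤ p),
      (∃ ε : ℝ, 0 < ε ∧ ε < 1 ∧ ∀ δ : ℝ, 0 < δ → ∃ j : ℕ, 1 ≤ j ∧
        Summable fun n : Set.Ici j => ε ^ (-α ((n : ℕ) - j) + δ * α (n : ℕ))) →
      (∃ T : PowerSeriesSpace 𝕜 p hp r α →L[𝕜] PowerSeriesSpace 𝕜 p hp r α,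
        IsWeightedShift (PowerSeriesSpace.coord 𝕜 p hp r α) T ∧ IsChaotic T) ∧
      (∃ T : PowerSeriesSpace 𝕜 p hp r α →L[𝕜] PowerSeriesSpace 𝕜 p hp r α,
        IsWeightedShift (PowerSeriesSpace.coord 𝕜 p hp r α) T ∧
          IsFrequentlyHypercyclic T ∧ ¬ IsChaotic T)) ∧
    (limsup (fun j : ℕ => liminf (fun n => ((α (n + j) / α n : ℝ) : EReal)) atTop) atTop = ⊤ →
      (∃ T : PowerSeriesSpaceZero 𝕜 r α →L[𝕜] PowerSeriesSpaceZero 𝕜 r α,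
        IsWeightedShift (PowerSeriesSpaceZero.coord 𝕜 r α) T ∧ IsChaotic T) ∧
      (∃ T : PowerSeriesSpaceZero 𝕜 r α →L[𝕜] PowerSeriesSpaceZero 𝕜 r α,
        IsWeightedShift (PowerSeriesSpaceZero.coord 𝕜 r α) T ∧
          IsFrequentlyHypercyclic T ∧ ¬ IsChaotic T)) := by
  have hslow := exists_forall_succ_le_mul hα_pos hα_quot
  refine ⟨fun p hp ⟨ε, hε0, hε1, h⟩ => ?_, fun h => ?_⟩
  · exact (PowerSeriesSpace.isWeightedSupSpace hp hα_pos
      (summable_exp_neg_mul hα_pos hε0 hε1 h) r).exists_weightedShifts hα_pos hα_mono hα_lim hslow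
      (exists_eventually_mul_le_of_summable hα_pos hε0 hε1 h)
  · exact (PowerSeriesSpaceZero.isWeightedSupSpace hα_pos r).exists_weightedShifts hα_pos hα_mono
      hα_lim hslow (exists_eventually_mul_le_of_limsup_eq_top hα_pos h)
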